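/- Let $H(\mathbb{C})$ be the complex vector space of all entire functions $f:\mathbb{C}\to\mathbb{C}$, equipped with the compact-open topology (uniform convergence on compact sets). For $\mu\in\mathbb{C}$ let $T_\mu:H(\mathbb{C})\to H(\mathbb{C})$ be the linear operator $(T_\mu f)(z)=f'(\mu z)$, where $f'(\mu z)$ is the derivative of $f$ evaluated at $\mu z$. A continuous linear operator $T$ on a separable topological vector space $X$ is called frequently hypercyclic if there is a vector $x\in X$ such that, for every nonempty open set $U\subset X$, the set $A=\{n\in\mathbb{N}: T^n x\in U\}$ has positive lower density, that is, $$\liminf_{N\to\infty}\frac{\operatorname{card}\{n\in A: n\le N\}}{N}>0 .$$ Proposition. For every $\mu\in\mathbb{C}$ with $|\mu|\ge 1$, the operator $T_\mu$ is continuous and frequently hypercyclic on $H(\mathbb{C})$. -/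

import Mathlib

/-- The lower density `liminf_{N → ∞} card {n ∈ A : n ≤ N} / N` of a set `A` of natural numbers.
The sequence of quotients is bounded (it takes values in `[0, 2]`), so this real `liminf` is the
usual one. -/
noncomputable def lowerDensity (A : Set ℕ) : ℝ :=
  Filter.liminf (fun N : ℕ => (({n : ℕ | n ∈ A ∧ n ≤ N}.ncard : ℕ) : ℝ) / (N : ℝ)) Filter.atTop

/-- The set `N(x, U)` of the times `n` at which the orbit of `x` under `T` visits `U`. -/
def returnTimes {𝕜 X : Type*} [Semiring 𝕜] [AddCommMonoid X] [Module 𝕜 X]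
    (T : X →ₗ[𝕜] X) (x : X) (U : Set X) : Set ℕ :=
  {n : ℕ | (T ^ n) x ∈ U}

/-- `x` is a frequently hypercyclic vector for `T`: its orbit visits every nonempty open set
along a set of times of positive lower density. -/
def IsFrequentlyHypercyclicVector {𝕜 X : Type*} [Semiring 𝕜] [AddCommMonoid X] [Module 𝕜 X]
    [TopologicalSpace X] (T : X →ₗ[𝕜] X) (x : X) : Prop :=
  ∀ U : Set X, IsOpen U → U.Nonempty → 0 < lowerDensity (returnTimes T x U)

/-- A linear operator `T` on a separable topological vector space `X` is frequently hypercyclic if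
it is continuous and has a frequently hypercyclic vector. -/
def IsFrequentlyHypercyclic {𝕜 X : Type*} [NontriviallyNormedField 𝕜] [AddCommGroup X] [Module 𝕜 X]
    [TopologicalSpace X] [IsTopologicalAddGroup X] [ContinuousSMul 𝕜 X]
    [TopologicalSpace.SeparableSpace X] (T : X →ₗ[𝕜] X) : Prop :=
  Continuous T ∧ ∃ x : X, IsFrequentlyHypercyclicVector T x

/-- The space `H(ℂ)` of entire functions, as a linear subspace of `C(ℂ, ℂ)`. Its topology is the
one induced by the compact-open topology of `C(ℂ, ℂ)`. -/
def EntireFunctions : Submodule ℂ C(ℂ, ℂ) where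
  carrier := {f | Differentiable ℂ (f : ℂ → ℂ)}
  add_mem' hf hg := Differentiable.add hf hg
  zero_mem' := differentiable_const (0 : ℂ)
  smul_mem' c _ hf := Differentiable.const_smul hf c

instance instSeparableSpaceEntireFunctions : TopologicalSpace.SeparableSpace EntireFunctions :=
  haveI : SecondCountableTopology EntireFunctions :=
    TopologicalSpace.Subtype.secondCountableTopology (EntireFunctions : Set C(ℂ, ℂ))
  inferInstance

theorem differentiable_deriv_comp_mul {f : ℂ → ℂ} (hf : Differentiable ℂ f) (μ : ℂ) :
    Differentiable ℂ (fun z : ℂ => deriv f (μ * z)) :=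
  hf.deriv.comp (differentiable_id.const_mul μ)

/-- The operator `T_μ` on `H(ℂ)` given by `(T_μ f)(z) = f'(μ z)`. -/
noncomputable def derivDilation (μ : ℂ) : EntireFunctions →ₗ[ℂ] EntireFunctions where
  toFun f :=
    ⟨⟨fun z : ℂ => deriv (f : C(ℂ, ℂ)) (μ * z),
      (differentiable_deriv_comp_mul f.2 μ).continuous⟩, differentiable_deriv_comp_mul f.2 μ⟩
  map_add' f g := by
    ext z
    exact deriv_add (f.2 (μ * z)) (g.2 (μ * z))
  map_smul' c f := by
    ext z
    exact deriv_const_smul c (f.2 (μ * z))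

/-! In the coordinates `a j = μ ^ j.choose 2 * f⁽ʲ⁾(0)` the operator is the backward shift, and
since `|μ| ≥ 1` every sequence with `|b j| ≤ j` comes from an entire function. So one sequence `b`
suffices. Cut `ℕ` into blocks; block `k` has type `t = v₂(k + 1)` and copies the coordinates of the
dense function `G l`, `l = t.unpair.1`, where these are at most `t` in norm. Shifting to the start
of such a block gives `G l` up to an error that vanishes for small `j` and is at most `j + |a j|`
elsewhere, hence is small on discs for large `t`. Blocks of a fixed type recur with positive lower
density. -/

open Filter Topology

/-- A set of natural numbers containing a sequence of distinct elements of at most linear growth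
has positive lower density. -/
theorem lowerDensity_pos_of_injective {A : Set ℕ} {u : ℕ → ℕ} {D : ℕ} (hD : 0 < D)
    (hu : Function.Injective u) (huA : ∀ i, u i ∈ A) (hbound : ∀ i, u i ≤ D * (i + 1)) :
    0 < lowerDensity A := by
  have hfin : ∀ N : ℕ, {n : ℕ | n ∈ A ∧ n ≤ N}.Finite := fun N =>
    (Set.finite_Iic N).subset fun n hn => hn.2
  have hcount : ∀ N : ℕ, N / D ≤ {n : ℕ | n ∈ A ∧ n ≤ N}.ncard := by
    intro N
    have hsub : u '' (Set.Iio (N / D)) ⊆ {n : ℕ | n ∈ A ∧ n ≤ N} := by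
      rintro _ ⟨i, hi, rfl⟩
      refine ⟨huA i, (hbound i).trans ?_⟩
      calc D * (i + 1) ≤ D * (N / D) := Nat.mul_le_mul_left _ hi
        _ ≤ N := Nat.mul_div_le N D
    have h := Set.ncard_le_ncard hsub (hfin N)
    rwa [Set.ncard_image_of_injective _ hu, Set.ncard_Iio_nat] at h
  have hupper : ∀ N : ℕ, {n : ℕ | n ∈ A ∧ n ≤ N}.ncard ≤ N + 1 := by
    intro N
    have h := Set.ncard_le_ncard (s := {n : ℕ | n ∈ A ∧ n ≤ N}) (t := Set.Iic N)
      (fun n hn => hn.2) (Set.finite_Iic N)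
    rwa [Set.ncard_Iic_nat] at h
  have hD' : (0 : ℝ) < D := by exact_mod_cast hD
  refine lt_of_lt_of_le (show (0 : ℝ) < 1 / (2 * D) by positivity) ?_
  refine le_liminf_of_le ?_ ?_
  -- A real `liminf` is meaningful only with an upper bound on the quotients; here `(N + 1) / N ≤
  -- 2`.
  · refine IsBoundedUnder.isCoboundedUnder_ge ⟨2, ?_⟩
    rw [eventually_map]
    filter_upwards [eventually_ge_atTop 1] with N hN
    have hN' : (1 : ℝ) ≤ N := by exact_mod_cast hN
    rw [div_le_iff₀ (by linarith)]
    have : (({n : ℕ | n ∈ A ∧ n ≤ N}.ncard : ℕ) : ℝ) ≤ N + 1 := by exact_mod_cast hupper N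
    linarith
  · filter_upwards [eventually_ge_atTop (2 * D)] with N hN
    have hN' : (2 * D : ℝ) ≤ N := by exact_mod_cast hN
    rw [le_div_iff₀ (by linarith)]
    refine le_trans ?_ (Nat.cast_le.mpr (hcount N))
    have h1 : N < D * (N / D + 1) := by
      have := Nat.lt_mul_div_succ N hD
      exact this
    have h2 : (N : ℝ) < D * (((N / D : ℕ) : ℝ) + 1) := by exact_mod_cast h1
    rw [one_div_mul_eq_div, div_le_iff₀ (by positivity)]
    nlinarith

/-! ### Blocks indexed by 2-adic valuations -/

/-- The position of the `k`-th block: consecutive positions `k`, `k + 1` are at distance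
`v₂ (k + 1) + v₂ (k + 2) + 1`. -/
def blockPosition (k : ℕ) : ℕ :=
  k + padicValNat 2 k.factorial + padicValNat 2 (k + 1).factorial

theorem padicValNat_two_factorial_succ (k : ℕ) :
    padicValNat 2 (k + 1).factorial = padicValNat 2 (k + 1) + padicValNat 2 k.factorial := by
  rw [Nat.factorial_succ, padicValNat.mul (Nat.succ_ne_zero k) (Nat.factorial_ne_zero k)]

theorem blockPosition_succ (k : ℕ) :
    blockPosition (k + 1) =
      blockPosition k + (padicValNat 2 (k + 1) + padicValNat 2 (k + 2) + 1) := by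
  have h1 := padicValNat_two_factorial_succ k
  have h2 := padicValNat_two_factorial_succ (k + 1)
  simp only [blockPosition, show k + 1 + 1 = k + 2 from rfl] at *
  omega

theorem blockPosition_zero : blockPosition 0 = 0 := by
  simp [blockPosition]

theorem blockPosition_strictMono : StrictMono blockPosition :=
  strictMono_nat_of_lt_succ fun k => by rw [blockPosition_succ]; omega

theorem blockPosition_le (k : ℕ) : blockPosition k ≤ 3 * (k + 1) := by
  have h1 := padicValNat_factorial_le 2 k
  have h2 := padicValNat_factorial_le 2 (k + 1)
  simp only [blockPosition]
  omega

/-- The gap before each block reserves room equal to its type. Seen from an earlier start, its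
entries, bounded by its type, are therefore bounded by their offset. -/
theorem blockPosition_add_le {k k' : ℕ} (h : k < k') :
    blockPosition k + padicValNat 2 (k' + 1) ≤ blockPosition k' := by
  obtain ⟨i, rfl⟩ := Nat.exists_eq_add_of_lt h
  have h1 := blockPosition_strictMono.monotone (show k ≤ k + i by omega)
  have h2 := blockPosition_succ (k + i)
  rw [show k + i + 1 + 1 = k + i + 2 by ring]
  omega

/-- Every natural number lies in one and only one block. -/
theorem exists_unique_block (m : ℕ) :
    ∃! k, blockPosition k ≤ m ∧ m < blockPosition (k + 1) := by
  have h0 : blockPosition 0 ≤ m := by simp [blockPosition_zero]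
  refine ⟨Nat.findGreatest (fun k => blockPosition k ≤ m) m, ⟨?_, ?_⟩, ?_⟩
  · exact Nat.findGreatest_spec (P := fun k => blockPosition k ≤ m) (Nat.zero_le m) h0
  · by_contra! hcon
    have hle : Nat.findGreatest (fun k => blockPosition k ≤ m) m + 1 ≤ m :=
      (blockPosition_strictMono.id_le _).trans hcon
    have := Nat.le_findGreatest (P := fun k => blockPosition k ≤ m) hle hcon
    omega
  · rintro k ⟨hk1, hk2⟩
    refine ((Nat.findGreatest_eq_iff).mpr
      ⟨(blockPosition_strictMono.id_le k).trans hk1, fun _ => hk1, ?_⟩).symm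
    intro n hn _ hcon
    have := blockPosition_strictMono.monotone (show k + 1 ≤ n from hn)
    omega

/-- A single sequence containing, with positive frequency, arbitrarily long initial parts of all
the given sequences `γ l`, and growing at most linearly after the start of each block. -/
theorem exists_concatenation (γ : ℕ → ℕ → ℂ) : ∃ b : ℕ → ℂ, (∀ m, ‖b m‖ ≤ m) ∧
    ∀ k j t l : ℕ, padicValNat 2 (k + 1) = t → t.unpair.1 = l →
      (j < t → ‖γ l j‖ ≤ t → b (blockPosition k + j) = γ l j) ∧
      ‖b (blockPosition k + j) - γ l j‖ ≤ j + ‖γ l j‖ := by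
  classical
  let c : ℕ → ℕ → ℂ := fun t j => if ‖γ t.unpair.1 j‖ ≤ t then γ t.unpair.1 j else 0
  have hc : ∀ t j, ‖c t j‖ ≤ t := by
    intro t j
    by_cases h : ‖γ t.unpair.1 j‖ ≤ t
    · simp [c, h]
    · simp [c, h]
  choose κ hκ huniq using exists_unique_block
  let b : ℕ → ℂ := fun m => c (padicValNat 2 (κ m + 1)) (m - blockPosition (κ m))
  have hb : ∀ k m, blockPosition k ≤ m → m < blockPosition (k + 1) →
      b m = c (padicValNat 2 (k + 1)) (m - blockPosition k) := by
    intro k m h1 h2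
    have : k = κ m := huniq m k ⟨h1, h2⟩
    simp only [b, this]
  have hfar : ∀ k j, blockPosition (k + 1) ≤ blockPosition k + j →
      ‖b (blockPosition k + j)‖ ≤ j := by
    intro k j hj
    set m := blockPosition k + j with hm
    have hlt : k < κ m := by
      by_contra! hcon
      have := blockPosition_strictMono.monotone (show κ m + 1 ≤ k + 1 by omega)
      have := (hκ m).2
      omega
    have h1 := blockPosition_add_le hlt
    have h2 := (hκ m).1
    refine (hc _ _).trans ?_
    exact_mod_cast (show padicValNat 2 (κ m + 1) ≤ j by omega)
  refine ⟨b, fun m => ?_, ?_⟩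
  · by_cases hm : blockPosition 1 ≤ m
    · have := hfar 0 m (by simpa [blockPosition_zero] using hm)
      simpa [blockPosition_zero] using this
    -- Block `0` has type `v₂(1) = 0`, so `b` vanishes on it.
    · rw [hb 0 m (by simp [blockPosition_zero]) (by simpa using hm)]
      refine (hc _ _).trans ?_
      simp
  · rintro k j t l rfl rfl
    have hs := blockPosition_succ k
    have hin : j < padicValNat 2 (k + 1) + padicValNat 2 (k + 2) + 1 →
        b (blockPosition k + j) = c (padicValNat 2 (k + 1)) j := by
      intro hj
      rw [hb k _ (by omega) (by omega)]
      simp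
    refine ⟨fun hj hγ => ?_, ?_⟩
    · rw [hin (by omega)]
      simp [c, hγ]
    · by_cases hj : j < padicValNat 2 (k + 1) + padicValNat 2 (k + 2) + 1
      · rw [hin hj]
        simp only [c]
        split_ifs
        · simp only [sub_self, norm_zero]; positivity
        · simp
      · exact (norm_sub_le _ _).trans (add_le_add_left (hfar k j (by omega)) _)

/-- The blocks of a given type `t` start at a set of positions with positive lower density. -/
theorem lowerDensity_pos_of_blocks {A : Set ℕ} (t : ℕ)
    (h : ∀ k, padicValNat 2 (k + 1) = t → blockPosition k ∈ A) : 0 < lowerDensity A := by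
  have hpos : ∀ i, 1 ≤ 2 ^ t * (2 * i + 1) := fun i => Nat.succ_le_of_lt (by positivity)
  -- Type `t` means `k + 1 = 2 ^ t * (2 * i + 1)`, and the position is at most `3 * (k + 1)`.
  refine lowerDensity_pos_of_injective (u := fun i => blockPosition (2 ^ t * (2 * i + 1) - 1))
    (D := 3 * 2 ^ t * 2) (by positivity) ?_ ?_ ?_
  · intro i i' hii
    have h1 := blockPosition_strictMono.injective hii
    have h2 : 2 ^ t * (2 * i + 1) = 2 ^ t * (2 * i' + 1) := by
      have := hpos i; have := hpos i'; omega
    have := Nat.eq_of_mul_eq_mul_left (by positivity) h2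
    omega
  · intro i
    refine h _ ?_
    rw [Nat.sub_add_cancel (hpos i), padicValNat.mul (by positivity) (by omega),
      padicValNat.prime_pow, padicValNat.eq_zero_of_not_dvd (by omega), add_zero]
  · intro i
    refine (blockPosition_le _).trans ?_
    rw [Nat.sub_add_cancel (hpos i)]
    nlinarith [Nat.zero_le (2 ^ t)]

/-! ### Taylor coefficients of entire functions -/

theorem summable_natCast_mul_pow_div_factorial (r : ℝ) :
    Summable fun j : ℕ => (j : ℝ) * (r ^ j / (j.factorial : ℝ)) := by
  rw [← summable_nat_add_iff 1]
  refine ((Real.summable_pow_div_factorial r).mul_left r).congr fun j => ?_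
  rw [Nat.factorial_succ]
  have : (j.factorial : ℝ) ≠ 0 := by exact_mod_cast j.factorial_ne_zero
  push_cast
  field_simp
  ring

theorem summable_norm_iteratedDeriv_mul_pow {f : ℂ → ℂ} (hf : Differentiable ℂ f) (r : ℝ) :
    Summable fun j : ℕ => ‖iteratedDeriv j f 0‖ * (|r| ^ j / (j.factorial : ℝ)) := by
  have h := (Complex.hasSum_taylorSeries_of_entire hf 0 (r : ℂ)).summable.norm
  refine h.congr fun j => ?_
  simp only [sub_zero, smul_eq_mul, norm_mul, norm_inv, norm_pow, Complex.norm_real,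
    Real.norm_eq_abs, Complex.norm_natCast]
  ring

/-- An entire function with prescribed derivatives at the origin. -/
theorem exists_entire_iteratedDeriv_eq (a : ℕ → ℂ)
    (ha : ∀ r : ℝ, Summable fun j : ℕ => ‖a j‖ * (|r| ^ j / (j.factorial : ℝ))) :
    ∃ f : ℂ → ℂ, Differentiable ℂ f ∧ ∀ j, iteratedDeriv j f 0 = a j := by
  let p : FormalMultilinearSeries ℂ ℂ ℂ :=
    FormalMultilinearSeries.ofScalars ℂ fun j => a j / (j.factorial : ℂ)
  have hrad : p.radius = ⊤ := by
    refine ENNReal.eq_top_of_forall_nnreal_le fun r => p.le_radius_of_summable ?_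
    refine (ha r).congr fun j => ?_
    simp only [p, FormalMultilinearSeries.ofScalars_norm, norm_div, Complex.norm_natCast,
      NNReal.abs_eq]
    ring
  have hp : HasFPowerSeriesOnBall p.sum p 0 ⊤ := by
    have := p.hasFPowerSeriesOnBall (by rw [hrad]; exact ENNReal.zero_lt_top)
    rwa [hrad] at this
  have hd : Differentiable ℂ p.sum := by
    have := hp.differentiableOn
    rw [Metric.eball_top] at this
    exact differentiableOn_univ.mp this
  refine ⟨p.sum, hd, fun j => ?_⟩
  have heq := hp.hasFPowerSeriesAt.eq_formalMultilinearSeries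
    (hd.analyticAt 0).hasFPowerSeriesAt
  have hj := congrArg (fun q => FormalMultilinearSeries.coeff q j) heq
  simp only [p, FormalMultilinearSeries.coeff_ofScalars] at hj
  have hne : (j.factorial : ℂ) ≠ 0 := by exact_mod_cast j.factorial_ne_zero
  exact ((div_left_inj' hne).mp hj).symm

/-- Weierstrass: locally uniform convergence of holomorphic functions passes to derivatives. -/
theorem continuous_derivDilation (μ : ℂ) : Continuous (derivDilation μ) := by
  rw [continuous_induced_rng, continuous_iff_continuousAt]
  intro f
  have h1 : Tendsto (fun g : EntireFunctions => (g : C(ℂ, ℂ))) (𝓝 f) (𝓝 (f : C(ℂ, ℂ))) :=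
    continuous_subtype_val.tendsto f
  rw [ContinuousMap.tendsto_iff_tendstoLocallyUniformly,
    ← tendstoLocallyUniformlyOn_univ] at h1
  have h2 := h1.deriv (Eventually.of_forall fun g => g.2.differentiableOn) isOpen_univ
  rw [ContinuousAt, ContinuousMap.tendsto_iff_tendstoLocallyUniformly,
    ← tendstoLocallyUniformlyOn_univ]
  exact h2.comp (fun z => μ * z) (Set.mapsTo_univ _ _) (by fun_prop)

/-! ### Conjugation to the backward shift -/

/-- The coordinates of an entire function in which `derivDilation μ` is the backward shift. -/
noncomputable def shiftCoeff (μ : ℂ) (f : EntireFunctions) (j : ℕ) : ℂ :=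
  μ ^ j.choose 2 * iteratedDeriv j (f : C(ℂ, ℂ)) 0

/-- Differentiating `f'(μ z)` `j` times yields `μ ^ j`, which the weight absorbs since `(j +
1).choose 2 = j + j.choose 2`. -/
theorem shiftCoeff_derivDilation (μ : ℂ) (f : EntireFunctions) (j : ℕ) :
    shiftCoeff μ (derivDilation μ f) j = shiftCoeff μ f (j + 1) := by
  have hf : ContDiff ℂ j (deriv (f : C(ℂ, ℂ))) := f.2.deriv.contDiff
  have h := congrFun (iteratedDeriv_comp_const_mul hf μ) 0
  have h' : iteratedDeriv j (derivDilation μ f : C(ℂ, ℂ)) 0 =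
      μ ^ j * iteratedDeriv (j + 1) (f : C(ℂ, ℂ)) 0 := by
    rw [iteratedDeriv_succ']
    refine h.trans ?_
    simp
  rw [shiftCoeff, shiftCoeff, h', Nat.choose_succ_succ' j 1, Nat.choose_one_right, pow_add]
  ring

theorem shiftCoeff_derivDilation_pow (μ : ℂ) (f : EntireFunctions) (n j : ℕ) :
    shiftCoeff μ ((derivDilation μ ^ n) f) j = shiftCoeff μ f (n + j) := by
  induction n generalizing j with
  | zero => simp
  | succ n ih =>
    rw [pow_succ', Module.End.mul_apply, shiftCoeff_derivDilation, ih]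
    congr 1
    ring

/-- Entire functions with close coordinates are close on discs. -/
theorem norm_sub_le_of_shiftCoeff {μ : ℂ} (hμ : 1 ≤ ‖μ‖) (f g : EntireFunctions) {r s : ℝ}
    {B : ℕ → ℝ} (hB : HasSum B s)
    (h : ∀ j, ‖shiftCoeff μ f j - shiftCoeff μ g j‖ / ‖μ‖ ^ j.choose 2 *
      (r ^ j / (j.factorial : ℝ)) ≤ B j) {z : ℂ} (hz : ‖z‖ ≤ r) :
    ‖(f : C(ℂ, ℂ)) z - (g : C(ℂ, ℂ)) z‖ ≤ s := by
  have hμ0 : 0 < ‖μ‖ := by linarith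
  have hsum := (Complex.hasSum_taylorSeries_of_entire f.2 0 z).sub
    (Complex.hasSum_taylorSeries_of_entire g.2 0 z)
  rw [← hsum.tsum_eq]
  refine tsum_of_norm_bounded hB fun j => le_trans ?_ (h j)
  simp only [shiftCoeff, sub_zero, smul_eq_mul, ← mul_sub, norm_mul, norm_inv, norm_pow,
    Complex.norm_natCast]
  rw [mul_div_cancel_left₀ _ (by positivity)]
  calc _ = ‖iteratedDeriv j (f : C(ℂ, ℂ)) 0 - iteratedDeriv j (g : C(ℂ, ℂ)) 0‖ *
        (‖z‖ ^ j / (j.factorial : ℝ)) := by ring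
    _ ≤ _ := by gcongr

/-- For `|μ| ≥ 1`, dividing by the weights only shrinks the derivatives, and `∑ j * r ^ j / j!`
converges. -/
theorem exists_shiftCoeff_eq {μ : ℂ} (hμ : 1 ≤ ‖μ‖) (b : ℕ → ℂ) (hb : ∀ j, ‖b j‖ ≤ j) :
    ∃ f : EntireFunctions, ∀ j, shiftCoeff μ f j = b j := by
  have hμ0 : μ ≠ 0 := norm_pos_iff.mp (by linarith)
  obtain ⟨f, hf, hfj⟩ := exists_entire_iteratedDeriv_eq (fun j => b j / μ ^ j.choose 2) (by
    intro r
    refine Summable.of_nonneg_of_le (fun j => by positivity) (fun j => ?_)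
      (summable_natCast_mul_pow_div_factorial |r|)
    gcongr
    rw [norm_div, norm_pow]
    exact (div_le_self (norm_nonneg _) (one_le_pow₀ hμ)).trans (hb j))
  refine ⟨⟨⟨f, hf.continuous⟩, hf⟩, fun j => ?_⟩
  simp only [shiftCoeff, ContinuousMap.coe_mk, hfj]
  field_simp

/-- A neighbourhood of an entire function contains all entire functions close to it on some
disc. -/
theorem exists_disc_of_mem_nhds {f : EntireFunctions} {U : Set EntireFunctions} (hU : U ∈ 𝓝 f) :
    ∃ r : ℝ, 0 ≤ r ∧ ∃ ε : ℝ, 0 < ε ∧ ∀ g : EntireFunctions,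
      (∀ z : ℂ, ‖z‖ ≤ r → ‖(g : C(ℂ, ℂ)) z - (f : C(ℂ, ℂ)) z‖ < ε) → g ∈ U := by
  obtain ⟨V, hV, hVU⟩ := mem_nhds_subtype _ f U |>.mp hU
  obtain ⟨⟨K, ε⟩, ⟨hK, hε⟩, hKV⟩ := (nhds_basis_uniformity'
    (Metric.uniformity_basis_dist (α := ℂ)).compactConvergenceUniformity).mem_iff.mp hV
  obtain ⟨r, hr⟩ := hK.isBounded.subset_closedBall 0
  refine ⟨max r 0, le_max_right _ _, ε, hε, fun g hg => hVU (hKV fun z hz => ?_)⟩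
  have hz' : ‖z‖ ≤ r := by simpa using hr hz
  have := hg z (hz'.trans (le_max_left _ _))
  rwa [← dist_eq_norm, dist_comm] at this

/-- Convergence to zero of the error made by keeping only finitely many bounded coordinates. -/
theorem tendsto_tsum_truncation {w : ℕ → ℝ} (hw : Summable w) (v : ℕ → ℝ) :
    Tendsto (fun t : ℕ => ∑' j, if j < t ∧ v j ≤ t then 0 else w j) atTop (𝓝 0) := by
  have h := tendsto_tsum_of_dominated_convergence (𝓕 := atTop) (bound := fun j => ‖w j‖)
    (f := fun t j => if j < t ∧ v j ≤ t then 0 else w j) (g := fun _ => (0 : ℝ)) hw.norm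
    (fun j => by
      refine tendsto_const_nhds.congr' ?_
      filter_upwards [eventually_gt_atTop j, eventually_ge_atTop ⌈v j⌉₊] with t h1 h2
      rw [if_pos ⟨h1, Nat.ceil_le.mp h2⟩])
    (Eventually.of_forall fun t j => by split_ifs <;> simp)
  simpa using h

theorem mainTheorem5 (μ : ℂ) (hμ : 1 ≤ ‖μ‖) :
    IsFrequentlyHypercyclic (𝕜 := ℂ) (X := EntireFunctions) (derivDilation μ) := by
  refine ⟨continuous_derivDilation μ, ?_⟩
  have hμ0 : 0 < ‖μ‖ := by linarith
  let G : ℕ → EntireFunctions := TopologicalSpace.denseSeq EntireFunctions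
  obtain ⟨b, hb, hblock⟩ := exists_concatenation fun l j => shiftCoeff μ (G l) j
  obtain ⟨f, hf⟩ := exists_shiftCoeff_eq hμ b hb
  refine ⟨f, fun U hU hne => ?_⟩
  obtain ⟨l, hl⟩ := (TopologicalSpace.denseRange_denseSeq EntireFunctions).exists_mem_open hU hne
  obtain ⟨r, hr, ε, hε, hdisc⟩ := exists_disc_of_mem_nhds (hU.mem_nhds hl)
  let w : ℕ → ℝ := fun j => (j + ‖shiftCoeff μ (G l) j‖) / ‖μ‖ ^ j.choose 2 *
    (r ^ j / (j.factorial : ℝ))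
  have hw : Summable w := by
    have h1 := (summable_natCast_mul_pow_div_factorial r).add
      (summable_norm_iteratedDeriv_mul_pow (G l).2 r)
    refine Summable.of_nonneg_of_le (fun j => by positivity) (fun j => ?_) h1
    simp only [w]
    rw [abs_of_nonneg hr, ← add_mul, add_div]
    gcongr
    · exact div_le_self (by positivity) (one_le_pow₀ hμ)
    · rw [shiftCoeff, norm_mul, norm_pow, mul_div_cancel_left₀ _ (by positivity)]
  -- Infinitely many types `t` encode the same `l`, so `t` may be taken large with `l` fixed.
  have hpair : Tendsto (fun i : ℕ => Nat.pair l i) atTop atTop :=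
    tendsto_atTop_mono (Nat.right_le_pair l) tendsto_id
  obtain ⟨i, hi⟩ := (((tendsto_tsum_truncation hw fun j => ‖shiftCoeff μ (G l) j‖).comp
    hpair).eventually_lt_const hε).exists
  set t := Nat.pair l i with ht
  refine lowerDensity_pos_of_blocks t fun k hk => hdisc _ fun z hz => lt_of_le_of_lt ?_ hi
  have hsum : Summable fun j => if j < t ∧ ‖shiftCoeff μ (G l) j‖ ≤ t then 0 else w j :=
    Summable.of_norm_bounded hw.norm fun j => by split_ifs <;> simp
  refine norm_sub_le_of_shiftCoeff hμ _ _ hsum.hasSum (fun j => ?_) hz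
  obtain ⟨h1, h2⟩ := hblock k j t l hk (by rw [ht, Nat.unpair_pair])
  rw [shiftCoeff_derivDilation_pow, hf]
  split_ifs with hj
  · rw [h1 hj.1 hj.2]
    simp [G]
  · simp only [w]
    gcongr
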